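/- Let $F$ be any field, $k \ge 1$, and let $V_1,\dots,V_k$ be finite-dimensional vector spaces over $F$. A tensor in $V_1\otimes\cdots\otimes V_k$ is called a *slice* if, for some $j$, it is of the form $x\otimes_j w$ with $x\in V_j$ and $w\in\bigotimes_{i\ne j}V_i$ (the factor $x$ being inserted at position $j$; in particular $0$ is a slice). The *slice rank* $\operatorname{rank}(t)$ of a tensor $t$ is the least integer $r\ge 0$ such that $t$ is a linear combination of $r$ slices. For $v\in V_1\otimes\cdots\otimes V_k$, the power $v^{\otimes n}$ is regarded as a $k$-tensor in $V_1^{\otimes n}\otimes\cdots\otimes V_k^{\otimes n}$. Put $$c_k:=\frac{k}{(k-1)^{(k-1)/k}}\qquad(\text{with } 0^0=1).$$ **Theorem.** Let $v\in V_1\otimes\cdots\otimes V_k$. 1. If $v$ is not a slice, then $\operatorname{rank}(v^{\otimes n})\ge c_k^{\,n+o(n)}$; that is, there is a sequence of real numbers $e(n)$ with $e(n)/n\to 0$ as $n\to\infty$ such that $\operatorname{rank}(v^{\otimes n})\ge c_k^{\,n+e(n)}$ for all $n\ge 0$. 2. Consequently, if $v\neq 0$, then either $v$ is a slice and its asymptotic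 slice rank is $1$, i.e. $\liminf_{n}\operatorname{rank}(v^{\otimes n})^{1/n}=\limsup_{n}\operatorname{rank}(v^{\otimes n})^{1/n}=1$, or $v$ is not a slice and its asymptotic slice rank is at least $c_k$, i.e. $\liminf_{n}\operatorname{rank}(v^{\otimes n})^{1/n}\ge c_k$. Moreover $1.889<c_3=3/2^{2/3}<1.890$. -/

import Mathlib

open scoped TensorProduct
open Filter Topology Asymptotics

noncomputable section

/-- The `j`-th tensor product `x ⊗_j w` of a vector `x ∈ V j` with a tensor `w` in the tensor product
of all the other spaces `V i`, `i ≠ j`: the factor `x` is inserted at position `j`. -/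
def tensorInsert {F : Type*} [Field F] {k : ℕ} {V : Fin k → Type*}
    [∀ i, AddCommGroup (V i)] [∀ i, Module F (V i)] (j : Fin k) (x : V j)
    (w : ⨂[F] i : ({j}ᶜ : Set (Fin k)), V i) : ⨂[F] i, V i :=
  (PiTensorProduct.equivPiTensorComplSingletonTensor F V j).symm (w ⊗ₜ[F] x)

/-- Slice tensors: tensors `x ⊗_j w` for some direction `j`. In particular `0` is a slice as soon as
there is a direction. -/
def IsSliceTensor {F : Type*} [Field F] {k : ℕ} {V : Fin k → Type*}
    [∀ i, AddCommGroup (V i)] [∀ i, Module F (V i)] (t : ⨂[F] i, V i) : Prop :=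
  ∃ (j : Fin k) (x : V j) (w : ⨂[F] i : ({j}ᶜ : Set (Fin k)), V i), t = tensorInsert j x w

/-- The slice rank: the least `r` such that `t` is a linear combination of `r` slice tensors.
(Such an `r` exists whenever `k ≥ 1`.) -/
def sliceRank {F : Type*} [Field F] {k : ℕ} {V : Fin k → Type*}
    [∀ i, AddCommGroup (V i)] [∀ i, Module F (V i)] (t : ⨂[F] i, V i) : ℕ :=
  sInf {r : ℕ | ∃ (c : Fin r → F) (s : Fin r → ⨂[F] i, V i),
    (∀ a, IsSliceTensor (s a)) ∧ t = ∑ a, c a • s a}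

/-- The bilinear map `M^{⊗n} × M → M^{⊗(n+1)}` that appends a factor. -/
def tensorPowerAppend (F : Type*) [Field F] (M : Type*) [AddCommGroup M] [Module F M] (n : ℕ) :
    (⨂[F]^n M) →ₗ[F] M →ₗ[F] (⨂[F]^(n + 1) M) :=
  ((TensorProduct.mk F (⨂[F]^n M) (⨂[F]^1 M)).compr₂
    (TensorPower.mulEquiv (R := F) (M := M) (n := n) (m := 1)).toLinearMap).compl₂
      (PiTensorProduct.subsingletonEquiv (R := F) (s := fun _ : Fin 1 => M) 0).symm.toLinearMap

/-- The `n`-th tensor power `v^{⊗n}` of a `k`-tensor `v ∈ V_1 ⊗ ⋯ ⊗ V_k`, regarded again as a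
`k`-tensor, with `i`-th factor the space `V_i^{⊗n}`. -/
def kTensorPow {F : Type*} [Field F] {k : ℕ} {V : Fin k → Type*}
    [∀ i, AddCommGroup (V i)] [∀ i, Module F (V i)] (v : ⨂[F] i, V i) :
    (n : ℕ) → ⨂[F] i, (⨂[F]^n (V i))
  | 0 => PiTensorProduct.tprod F fun _ => PiTensorProduct.tprod F fun a : Fin 0 => a.elim0
  | n + 1 => PiTensorProduct.map₂ (fun i => tensorPowerAppend F (V i) n) (kTensorPow v n) v

/-- The lower asymptotic slice rank `liminf rank(v^{⊗n})^{1/n}`, an extended real number. -/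
def lowerAsymptoticSliceRank {F : Type*} [Field F] {k : ℕ} {V : Fin k → Type*}
    [∀ i, AddCommGroup (V i)] [∀ i, Module F (V i)] (v : ⨂[F] i, V i) : EReal :=
  liminf (fun n : ℕ => (((sliceRank (kTensorPow v n) : ℝ) ^ (1 / (n : ℝ)) : ℝ) : EReal)) atTop

/-- The upper asymptotic slice rank `limsup rank(v^{⊗n})^{1/n}`, an extended real number. -/
def upperAsymptoticSliceRank {F : Type*} [Field F] {k : ℕ} {V : Fin k → Type*}
    [∀ i, AddCommGroup (V i)] [∀ i, Module F (V i)] (v : ⨂[F] i, V i) : EReal :=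
  limsup (fun n : ℕ => (((sliceRank (kTensorPow v n) : ℝ) ^ (1 / (n : ℝ)) : ℝ) : EReal)) atTop

/-- The constant `k / (k - 1)^{(k - 1) / k}`. -/
def sliceGap (k : ℕ) : ℝ :=
  (k : ℝ) / ((k : ℝ) - 1) ^ (((k : ℝ) - 1) / (k : ℝ))

end

/-!
The lower bound rests on testing tensors against linear functionals. Given, in every direction `i`,
a finite linearly ordered family of functionals `Φ i a` on `V i`, a tensor `v` becomes an array
`u ↦ v (Φ 1 (u 1), …, Φ k (u k))`, and only the maximal points of its support (in the product order)
matter.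

* A sum of `r` slices has array supports whose maximal points are covered by `r` coordinate
  hyperplanes (`exists_cover_of_sum_slices`). In direction `i`, a functional can be corrected by
  later ones so as to kill the vectors `x` of all slices in that direction, except for at most as
  many functionals as there are such slices. At a maximal point only the leading terms of the
  corrected functionals contribute, so some coordinate of the point must be one of the exceptions.
* If `v` is not a slice, the functionals can be chosen so that in no direction do all maximal points
  have the same coordinate (`exists_functionals_maximal_ne`). If all of them have `i`-th coordinate
  `b`, then, `v` not being a slice in direction `i`, some row `c`
  (the part of the array with `u i = c`) is not a multiple of row `b`;
  the functional `Φ i c - r • Φ i b`, with `r` chosen to kill the array at one maximal point, is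
  added on top of direction `i`. This repairs direction `i`, and the projection of the set of
  maximal points to the other directions loses no point. The argument works over every field.
* Two distinct maximal points are incomparable and hence differ in two coordinates, so `k` maximal
  points suffice to see every coordinate vary (`exists_family_maximal_nonconst`). Words of length
  `n` in these points are maximal for the `n`-th power, ordered lexicographically. The `n!`
  rearrangements of a balanced word must all be covered, while a single hyperplane covers at most
  `n! / n.choose (n / k)` of them. Therefore the slice rank of the `n`-th power is at least
  `n.choose (n / k)` (`choose_div_le_sliceRank`).

The term of index `m` is the largest one in the binomial expansion of `(1 + (k - 1)) ^ (k * m)`.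
With `m = n / k` it follows that this binomial coefficient is at least
`sliceGap k ^ (n - k) / (n + 1)` (`sliceGap_pow_div_le_choose`). Conversely, the powers of a nonzero slice are nonzero slices and
have slice rank `1`.
-/

/-! ### Values of a tensor on families of functionals -/

section Evaluation

variable {F : Type*} [Field F]

/-- The value of a tensor `t` on a family of functionals `f i`, as a multilinear function of `f`. -/
noncomputable def evalAt {ι : Type*} [Finite ι] {V : ι → Type*}
    [∀ i, AddCommGroup (V i)] [∀ i, Module F (V i)] (t : ⨂[F] i, V i) :
    MultilinearMap F (fun i => Module.Dual F (V i)) F :=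
  ((LinearMap.applyₗ t).comp PiTensorProduct.dualDistrib).compMultilinearMap
    (PiTensorProduct.tprod F)

theorem evalAt_apply {ι : Type*} [Finite ι] {V : ι → Type*}
    [∀ i, AddCommGroup (V i)] [∀ i, Module F (V i)] (t : ⨂[F] i, V i)
    (f : ∀ i, Module.Dual F (V i)) :
    evalAt t f = PiTensorProduct.dualDistrib (PiTensorProduct.tprod F f) t := rfl

theorem evalAt_tprod {ι : Type*} [Fintype ι] {V : ι → Type*}
    [∀ i, AddCommGroup (V i)] [∀ i, Module F (V i)] (x : ∀ i, V i)
    (f : ∀ i, Module.Dual F (V i)) :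
    evalAt (PiTensorProduct.tprod F x) f = ∏ i, f i (x i) := by
  rw [evalAt_apply, PiTensorProduct.dualDistrib_apply]

theorem repr_piTensorProduct_eq_evalAt {ι : Type*} [Finite ι] {V : ι → Type*}
    [∀ i, AddCommGroup (V i)] [∀ i, Module F (V i)] {κ : ι → Type*}
    (b : ∀ i, Module.Basis (κ i) F (V i)) (t : ⨂[F] i, V i) (p : ∀ i, κ i) :
    (Basis.piTensorProduct b).repr t p = evalAt t (fun i => (b i).coord (p i)) := by
  have := Fintype.ofFinite ι
  induction t using PiTensorProduct.induction_on with
  | smul_tprod r x =>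
    rw [evalAt_apply, map_smul, map_smul, ← evalAt_apply, evalAt_tprod]
    simp
  | add x y hx hy =>
    rw [evalAt_apply, map_add, map_add, ← evalAt_apply, ← evalAt_apply, ← hx, ← hy]
    rfl

theorem eq_of_evalAt_coord_eq {ι : Type*} [Finite ι] {V : ι → Type*}
    [∀ i, AddCommGroup (V i)] [∀ i, Module F (V i)] {κ : ι → Type*}
    (b : ∀ i, Module.Basis (κ i) F (V i)) {t t' : ⨂[F] i, V i}
    (h : ∀ p : ∀ i, κ i, evalAt t (fun i => (b i).coord (p i)) =
      evalAt t' (fun i => (b i).coord (p i))) : t = t' := by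
  refine (Basis.piTensorProduct b).ext_elem fun p => ?_
  rw [repr_piTensorProduct_eq_evalAt, repr_piTensorProduct_eq_evalAt, h]

end Evaluation

/-! ### Slices and contractions -/

section Slices

/-- A vector at position `j` and vectors at all other positions come from one family. -/
theorem exists_family_extending {k : ℕ} {V : Fin k → Type*} (j : Fin k) (x : V j)
    (m : ∀ i : ({j}ᶜ : Set (Fin k)), V i) :
    ∃ y : ∀ i, V i, y j = x ∧ (fun i : ({j}ᶜ : Set (Fin k)) => y i) = m := by
  classical
  refine ⟨fun i => if h : i = j then h ▸ x else m ⟨i, h⟩, by simp, ?_⟩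
  funext i
  have : (i : Fin k) ≠ j := i.2
  simp [this]

variable {F : Type*} [Field F] {k : ℕ} {V : Fin k → Type*}
  [∀ i, AddCommGroup (V i)] [∀ i, Module F (V i)]

theorem tensorInsert_tprod (j : Fin k) (y : ∀ i, V i) :
    tensorInsert j (y j) (PiTensorProduct.tprod F fun i : ({j}ᶜ : Set (Fin k)) => y i) =
      PiTensorProduct.tprod F y :=
  (LinearEquiv.symm_apply_eq _).2
    (PiTensorProduct.equivPiTensorComplSingletonTensor_tprod F V j y).symm

theorem tensorInsert_add (j : Fin k) (x : V j) (w w' : ⨂[F] i : ({j}ᶜ : Set (Fin k)), V i) :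
    tensorInsert j x (w + w') = tensorInsert j x w + tensorInsert j x w' := by
  simp only [tensorInsert, TensorProduct.add_tmul, map_add]

theorem tensorInsert_smul (j : Fin k) (x : V j) (r : F)
    (w : ⨂[F] i : ({j}ᶜ : Set (Fin k)), V i) :
    tensorInsert j x (r • w) = r • tensorInsert j x w := by
  rw [tensorInsert, ← TensorProduct.smul_tmul', map_smul, tensorInsert]

theorem evalAt_tensorInsert (j : Fin k) (x : V j) (w : ⨂[F] i : ({j}ᶜ : Set (Fin k)), V i)
    (f : ∀ i, Module.Dual F (V i)) :
    evalAt (tensorInsert j x w) f =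
      f j x * evalAt w (fun i : ({j}ᶜ : Set (Fin k)) => f i) := by
  classical
  induction w using PiTensorProduct.induction_on with
  | smul_tprod r m =>
    obtain ⟨y, rfl, rfl⟩ := exists_family_extending j x m
    rw [tensorInsert_smul, tensorInsert_tprod, evalAt_apply, evalAt_apply, map_smul, map_smul,
      ← evalAt_apply, ← evalAt_apply, evalAt_tprod, evalAt_tprod, smul_eq_mul, smul_eq_mul,
      ← Fintype.prod_subtype_mul_prod_subtype (fun i => i ∈ ({j}ᶜ : Set (Fin k)))
        (fun i => f i (y i))]
    have : ∏ i : {i // ¬ i ∈ ({j}ᶜ : Set (Fin k))}, f i (y i) = f j (y j) := by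
      rw [Fintype.prod_eq_single (⟨j, by simp⟩ : {i // ¬ i ∈ ({j}ᶜ : Set (Fin k))})]
      rintro ⟨i, hi⟩ h
      exact absurd (by simpa using hi) (by simpa using h)
    rw [this]
    have e : (∏ i : {i // i ∈ ({j}ᶜ : Set (Fin k))}, f i (y i)) =
      ∏ i : ({j}ᶜ : Set (Fin k)), f i (y i) := by congr!
    rw [e]
    ring
  | add w w' hw hw' =>
    rw [tensorInsert_add, evalAt_apply, evalAt_apply, map_add, map_add, ← evalAt_apply,
      ← evalAt_apply, ← evalAt_apply, ← evalAt_apply, hw, hw', mul_add]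

/-- The tensor `w` is the contraction of `t` with the functional `φ` in direction `j`. -/
theorem exists_contraction (j : Fin k) (φ : Module.Dual F (V j)) (t : ⨂[F] i, V i) :
    ∃ w : ⨂[F] i : ({j}ᶜ : Set (Fin k)), V i, ∀ f : ∀ i, Module.Dual F (V i), f j = φ →
      evalAt w (fun i : ({j}ᶜ : Set (Fin k)) => f i) = evalAt t f := by
  refine ⟨TensorProduct.rid F _ (LinearMap.lTensor _ φ
    (PiTensorProduct.equivPiTensorComplSingletonTensor F V j t)), ?_⟩
  rintro f rfl
  obtain ⟨z, rfl⟩ := (PiTensorProduct.equivPiTensorComplSingletonTensor F V j).symm.surjective t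
  rw [LinearEquiv.apply_symm_apply]
  induction z using TensorProduct.induction_on with
  | zero => simp [evalAt_apply]
  | tmul w x =>
    have := evalAt_tensorInsert j x w f
    rw [tensorInsert] at this
    rw [this]
    simp [evalAt_apply]
  | add a b ha hb =>
    simp only [evalAt_apply, map_add] at ha hb ⊢
    rw [ha, hb]

end Slices

/-! ### Tensor powers and the slice rank -/

section Powers

variable {F : Type*} [Field F]

theorem tensorPowerAppend_tprod {M : Type*} [AddCommGroup M] [Module F M] (n : ℕ)
    (a : Fin n → M) (x : M) :
    tensorPowerAppend F M n (PiTensorProduct.tprod F a) x =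
      PiTensorProduct.tprod F (Fin.snoc a x : Fin (n + 1) → M) := by
  have h : (PiTensorProduct.subsingletonEquiv (R := F) (s := fun _ : Fin 1 => M) 0).symm x =
      PiTensorProduct.tprod F (fun _ => x) := by
    rw [LinearEquiv.symm_apply_eq, PiTensorProduct.subsingletonEquiv_apply_tprod]
  have := TensorPower.tprod_mul_tprod F a (fun _ : Fin 1 => x)
  rw [TensorPower.gMul_def, Fin.append_right_eq_snoc] at this
  rw [← this, ← h]
  rfl

theorem evalAt_tensorPowerAppend {M : Type*} [AddCommGroup M] [Module F M] (n : ℕ)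
    (s : ⨂[F]^n M) (x : M) (g : Fin (n + 1) → Module.Dual F M) :
    evalAt (tensorPowerAppend F M n s x) g =
      evalAt s (fun l => g l.castSucc) * g (Fin.last n) x := by
  induction s using PiTensorProduct.induction_on with
  | smul_tprod r a =>
    simp only [evalAt_apply, map_smul, LinearMap.smul_apply, tensorPowerAppend_tprod,
      PiTensorProduct.dualDistrib_apply, Fin.prod_univ_castSucc, Fin.snoc_castSucc, Fin.snoc_last,
      smul_eq_mul, mul_assoc]
  | add s s' hs hs' =>
    simp only [evalAt_apply, map_add, LinearMap.add_apply] at hs hs' ⊢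
    rw [hs, hs', add_mul]

/-- The functional `g 0 ⊗ ⋯ ⊗ g (n - 1)` on the tensor power `M^{⊗n}`. -/
noncomputable def powerFunctional {M : Type*} [AddCommGroup M] [Module F M] {n : ℕ}
    (g : Fin n → Module.Dual F M) : Module.Dual F (⨂[F]^n M) :=
  PiTensorProduct.dualDistrib (PiTensorProduct.tprod F g)

variable {k : ℕ} {V : Fin k → Type*} [∀ i, AddCommGroup (V i)] [∀ i, Module F (V i)]

theorem evalAt_map₂_tensorPowerAppend (n : ℕ) (s : ⨂[F] i, (⨂[F]^n (V i))) (v : ⨂[F] i, V i)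
    (g : ∀ i, Fin (n + 1) → Module.Dual F (V i)) :
    evalAt (PiTensorProduct.map₂ (fun i => tensorPowerAppend F (V i) n) s v)
        (fun i => powerFunctional (g i)) =
      evalAt s (fun i => powerFunctional fun l => g i l.castSucc) *
        evalAt v (fun i => g i (Fin.last n)) := by
  induction s using PiTensorProduct.induction_on with
  | smul_tprod r a =>
    induction v using PiTensorProduct.induction_on with
    | smul_tprod r' x =>
      have h : ∀ i, powerFunctional (g i) (tensorPowerAppend F (V i) n (a i) (x i)) =
          powerFunctional (fun l => g i l.castSucc) (a i) * g i (Fin.last n) (x i) :=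
        fun i => evalAt_tensorPowerAppend n (a i) (x i) (g i)
      simp only [evalAt_apply, map_smul, LinearMap.smul_apply, PiTensorProduct.map₂_tprod_tprod,
        PiTensorProduct.dualDistrib_apply, h, Finset.prod_mul_distrib, smul_eq_mul]
      ring
    | add v v' hv hv' =>
      simp only [evalAt_apply, map_add] at hv hv' ⊢
      rw [hv, hv', mul_add]
  | add s s' hs hs' =>
    simp only [evalAt_apply, map_add, LinearMap.add_apply] at hs hs' ⊢
    rw [hs, hs', add_mul]

/-- The array of values of `v^{⊗n}` is the `n`-th power of the array of values of `v`. -/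
theorem evalAt_kTensorPow (v : ⨂[F] i, V i) (n : ℕ) (g : ∀ i, Fin n → Module.Dual F (V i)) :
    evalAt (kTensorPow v n) (fun i => powerFunctional (g i)) =
      ∏ l, evalAt v (fun i => g i l) := by
  induction n with
  | zero =>
    rw [kTensorPow, evalAt_tprod]
    simp [powerFunctional]
  | succ n ih =>
    rw [kTensorPow, evalAt_map₂_tensorPowerAppend, ih, Fin.prod_univ_castSucc]

theorem exists_evalAt_ne_zero [∀ i, FiniteDimensional F (V i)] {v : ⨂[F] i, V i} (hv : v ≠ 0) :
    ∃ f, evalAt v f ≠ 0 := by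
  by_contra! h
  refine hv (eq_of_evalAt_coord_eq (fun i => Module.finBasis F (V i)) fun p => ?_)
  rw [h, evalAt_apply, map_zero]

theorem kTensorPow_ne_zero [∀ i, FiniteDimensional F (V i)] {v : ⨂[F] i, V i} (hv : v ≠ 0)
    (n : ℕ) : kTensorPow v n ≠ 0 := by
  obtain ⟨f, hf⟩ := exists_evalAt_ne_zero hv
  intro h
  have := evalAt_kTensorPow v n (fun i _ => f i)
  rw [h, evalAt_apply, map_zero] at this
  exact Finset.prod_ne_zero_iff.2 (fun _ _ => hf) this.symm

/-- A factorwise bilinear product of two slices in the same direction is again a slice. -/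
theorem map₂_tensorInsert {V' V'' : Fin k → Type*}
    [∀ i, AddCommGroup (V' i)] [∀ i, Module F (V' i)]
    [∀ i, AddCommGroup (V'' i)] [∀ i, Module F (V'' i)]
    (φ : ∀ i, V i →ₗ[F] V' i →ₗ[F] V'' i) (j : Fin k) (x : V j) (x' : V' j)
    (w : ⨂[F] i : ({j}ᶜ : Set (Fin k)), V i) (w' : ⨂[F] i : ({j}ᶜ : Set (Fin k)), V' i) :
    PiTensorProduct.map₂ φ (tensorInsert j x w) (tensorInsert j x' w') =
      tensorInsert j (φ j x x')
        (PiTensorProduct.map₂ (fun i : ({j}ᶜ : Set (Fin k)) => φ i) w w') := by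
  induction w using PiTensorProduct.induction_on with
  | smul_tprod r m =>
    induction w' using PiTensorProduct.induction_on with
    | smul_tprod r' m' =>
      obtain ⟨y, rfl, rfl⟩ := exists_family_extending j x m
      obtain ⟨y', rfl, rfl⟩ := exists_family_extending j x' m'
      simp only [tensorInsert_smul, map_smul, LinearMap.smul_apply, tensorInsert_tprod,
        PiTensorProduct.map₂_tprod_tprod]
      rw [← tensorInsert_tprod j (fun i => φ i (y i) (y' i))]
    | add s s' hs hs' => simp only [tensorInsert_add, map_add, hs, hs']
  | add s s' hs hs' => simp only [tensorInsert_add, map_add, LinearMap.add_apply, hs, hs']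

theorem isSliceTensor_tprod (j : Fin k) (y : ∀ i, V i) :
    IsSliceTensor (PiTensorProduct.tprod F y) :=
  ⟨j, y j, PiTensorProduct.tprod F fun i : ({j}ᶜ : Set (Fin k)) => y i,
    (tensorInsert_tprod j y).symm⟩

theorem IsSliceTensor.kTensorPow {v : ⨂[F] i, V i} (hv : IsSliceTensor v) (n : ℕ) :
    IsSliceTensor (kTensorPow v n) := by
  obtain ⟨j, x, w, rfl⟩ := hv
  suffices ∃ X W, _root_.kTensorPow (tensorInsert j x w) n = tensorInsert j X W from
    ⟨j, this.choose, this.choose_spec.choose, this.choose_spec.choose_spec⟩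
  induction n with
  | zero => exact ⟨_, _, (tensorInsert_tprod j _).symm⟩
  | succ n ih =>
    obtain ⟨X, W, h⟩ := ih
    exact ⟨_, _, by rw [_root_.kTensorPow, h, map₂_tensorInsert]⟩

/-- The infimum defining the slice rank is attained, since pure tensors are slices. -/
theorem sliceRank_spec (hk : 1 ≤ k) (t : ⨂[F] i, V i) :
    ∃ (c : Fin (sliceRank t) → F) (s : Fin (sliceRank t) → ⨂[F] i, V i),
      (∀ a, IsSliceTensor (s a)) ∧ t = ∑ a, c a • s a := by
  refine Nat.sInf_mem (s := {r : ℕ | ∃ (c : Fin r → F) (s : Fin r → ⨂[F] i, V i),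
    (∀ a, IsSliceTensor (s a)) ∧ t = ∑ a, c a • s a}) ?_
  induction t using PiTensorProduct.induction_on with
  | smul_tprod r y =>
    exact ⟨1, fun _ => r, fun _ => PiTensorProduct.tprod F y,
      fun _ => isSliceTensor_tprod ⟨0, hk⟩ y, by simp⟩
  | add t t' ht ht' =>
    obtain ⟨r, c, s, hs, rfl⟩ := ht
    obtain ⟨r', c', s', hs', rfl⟩ := ht'
    refine ⟨r + r', Fin.append c c', Fin.append s s', fun a => ?_, ?_⟩
    · induction a using Fin.addCases with
      | left a => simpa using hs a
      | right a => simpa using hs' a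
    · simp [Fin.sum_univ_add]

theorem IsSliceTensor.sliceRank_eq_one (hk : 1 ≤ k) {t : ⨂[F] i, V i} (ht : IsSliceTensor t)
    (h0 : t ≠ 0) : sliceRank t = 1 := by
  refine le_antisymm (Nat.sInf_le ⟨fun _ => 1, fun _ => t, fun _ => ht, by simp⟩) ?_
  by_contra! h
  obtain ⟨c, s, -, hts⟩ := sliceRank_spec hk t
  have : IsEmpty (Fin (sliceRank t)) := by
    rw [Nat.lt_one_iff.1 h]
    infer_instance
  exact h0 (by rw [hts, Finset.univ_eq_empty, Finset.sum_empty])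

end Powers

/-! ### Covering the maximal points of the support by slices -/

section Covering

variable {F : Type*} [Field F]

/-- In a finite, linearly ordered family of vectors, those which are not in the span of the later
ones are linearly independent. -/
theorem card_notMem_span_Ioi_le_finrank {I M : Type*} [LinearOrder I] [Fintype I] [AddCommGroup M]
    [Module F M] [FiniteDimensional F M] (ψ : I → M)
    [DecidablePred fun u => ψ u ∉ Submodule.span F (ψ '' Set.Ioi u)] :
    (Finset.univ.filter fun u => ψ u ∉ Submodule.span F (ψ '' Set.Ioi u)).card ≤
      Module.finrank F M := by
  have hli : LinearIndependent F
      (fun u : {u // ψ u ∉ Submodule.span F (ψ '' Set.Ioi u)} => ψ u) := by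
    rw [Fintype.linearIndependent_iff]
    intro g hg i
    induction i using WellFoundedLT.induction with
    | ind i ih =>
      by_contra hi
      refine i.2 ?_
      have hsum : g i • ψ i = -∑ l ∈ Finset.univ.erase i, g l • ψ l := by
        rw [eq_neg_iff_add_eq_zero, Finset.add_sum_erase _ (fun l => g l • ψ l) (Finset.mem_univ i),
          hg]
      have hmem : g i • ψ i ∈ Submodule.span F (ψ '' Set.Ioi (i : I)) := by
        rw [hsum]
        refine Submodule.neg_mem _ (Submodule.sum_mem _ fun l hl => ?_)
        rcases lt_or_gt_of_ne (Finset.ne_of_mem_erase hl) with h | h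
        · rw [ih l h, zero_smul]
          exact Submodule.zero_mem _
        · exact Submodule.smul_mem _ _ (Submodule.subset_span ⟨l, h, rfl⟩)
      exact (Submodule.smul_mem_iff _ hi).1 hmem
  rw [← Fintype.card_subtype]
  exact hli.fintype_card_le_finrank

/-- A member of an ordered family lying in the span of the later ones is the leading term of a
linear relation. -/
theorem exists_relation_of_mem_span_Ioi {I M : Type*} [LinearOrder I] [Fintype I] [AddCommGroup M]
    [Module F M] {ψ : I → M} {u : I} (h : ψ u ∈ Submodule.span F (ψ '' Set.Ioi u)) :
    ∃ c : I → F, c u = 1 ∧ (∀ u' < u, c u' = 0) ∧ ∑ u', c u' • ψ u' = 0 := by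
  classical
  obtain ⟨l, hl, hlu⟩ := (Finsupp.mem_span_image_iff_linearCombination F).1 h
  have hzero : ∀ u' ≤ u, l u' = 0 := fun u' hu' =>
    Finsupp.notMem_support_iff.1 fun h' => (not_lt_of_ge hu') (hl h')
  refine ⟨fun u' => (Pi.single u 1 : I → F) u' - l u', ?_, fun u' hu' => ?_, ?_⟩
  · simp [hzero u le_rfl]
  · simp [hzero u' hu'.le, hu'.ne]
  · rw [Finsupp.linearCombination_apply, Finsupp.sum_fintype _ _ (by simp)] at hlu
    simp [sub_smul, Finset.sum_sub_distrib, hlu, Pi.single_apply, ite_smul]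

/-- If a tensor is a combination of `r` slices then, for linearly ordered families of functionals
in every direction, the maximal points of the support of the resulting array are covered by `r`
coordinate hyperplanes. -/
theorem exists_cover_of_sum_slices {k : ℕ} {V : Fin k → Type*} [∀ i, AddCommGroup (V i)]
    [∀ i, Module F (V i)] {I : Fin k → Type*} [∀ i, LinearOrder (I i)] [∀ i, Fintype (I i)]
    (Ψ : ∀ i, I i → Module.Dual F (V i)) {r : ℕ} (c : Fin r → F) (s : Fin r → ⨂[F] i, V i)
    (hs : ∀ a, IsSliceTensor (s a)) :
    ∃ B : ∀ i, Finset (I i), ∑ i, (B i).card ≤ r ∧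
      ∀ u, Maximal (fun u : ∀ i, I i =>
        evalAt (∑ a, c a • s a) (fun i => Ψ i (u i)) ≠ 0) u → ∃ i, u i ∈ B i := by
  classical
  choose j x w hw using hs
  let ψ : ∀ i, I i → ({a : Fin r // j a = i} → F) := fun i u a => Ψ i u (a.2 ▸ x a)
  refine ⟨fun i => Finset.univ.filter fun u => ψ i u ∉ Submodule.span F (ψ i '' Set.Ioi u),
    ?_, fun u hu => ?_⟩
  · calc _ ≤ ∑ i, Module.finrank F ({a : Fin r // j a = i} → F) :=
          Finset.sum_le_sum fun i _ => card_notMem_span_Ioi_le_finrank (ψ i)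
      _ = r := by
          simp only [Module.finrank_fintype_fun_eq_card]
          rw [← Fintype.card_sigma, Fintype.card_congr (Equiv.sigmaFiberEquiv j), Fintype.card_fin]
  by_contra! hB
  have hB' : ∀ i, ψ i (u i) ∈ Submodule.span F (ψ i '' Set.Ioi (u i)) := fun i => by
    simpa using hB i
  choose l hl1 hl0 hl using fun i => exists_relation_of_mem_span_Ioi (hB' i)
  -- These functionals kill every slice, but only their leading terms contribute to the value.
  let f : ∀ i, Module.Dual F (V i) := fun i => ∑ u', l i u' • Ψ i u'
  have hf : ∀ a, f (j a) (x a) = 0 := fun a => by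
    have := congrFun (hl (j a)) ⟨a, rfl⟩
    simpa [f, ψ] using this
  have h0 : evalAt (∑ a, c a • s a) f = 0 := by
    have : ∀ a, evalAt (s a) f = 0 := fun a => by rw [hw, evalAt_tensorInsert, hf, zero_mul]
    simp only [evalAt_apply] at this
    simp [evalAt_apply, this]
  refine hu.prop ?_
  rw [← h0, MultilinearMap.map_sum, Finset.sum_eq_single u]
  · simp [hl1]
  · intro p _ hpu
    rw [MultilinearMap.map_smul_univ]
    by_cases hp : u ≤ p
    · by_cases hT : evalAt (∑ a, c a • s a) (fun i => Ψ i (p i)) = 0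
      · rw [hT, smul_zero]
      · exact absurd (le_antisymm (hu.le_of_ge hT hp) hp) hpu
    · rw [Pi.le_def] at hp
      push Not at hp
      obtain ⟨i, hi⟩ := hp
      rw [Finset.prod_eq_zero (Finset.mem_univ i) (hl0 i _ hi), zero_smul]
  · simp

end Covering

/-! ### Maximal points of the support of a tensor which is not a slice -/

section MaximalPoints

variable {F : Type*} [Field F] {k : ℕ} {V : Fin k → Type*}
  [∀ i, AddCommGroup (V i)] [∀ i, Module F (V i)]

/-- The support of the array of values of `v` on the functionals `Φ i a`. -/
def valueSupport {I : Type*} (v : ⨂[F] i, V i) (Φ : ∀ i, I → Module.Dual F (V i)) :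
    Set (Fin k → I) :=
  {u | evalAt v (fun i => Φ i (u i)) ≠ 0}

/-- If `v` is not a slice, then for every direction `i` and functional `φ` some coordinate
contraction of `v` in direction `i` is not a multiple of the contraction with `φ`. -/
theorem exists_coord_not_proportional [∀ i, FiniteDimensional F (V i)] {v : ⨂[F] i, V i}
    (hv : ¬ IsSliceTensor v) (i : Fin k) (φ : Module.Dual F (V i)) :
    ∃ c : Fin (Module.finrank F (V i)), ∀ r : F, ∃ p : ∀ l, Fin (Module.finrank F (V l)),
      evalAt v (Function.update (fun l => (Module.finBasis F (V l)).coord (p l)) i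
        ((Module.finBasis F (V i)).coord c)) ≠
      r * evalAt v (Function.update (fun l => (Module.finBasis F (V l)).coord (p l)) i φ) := by
  by_contra! h
  choose r hr using h
  obtain ⟨w, hw⟩ := exists_contraction i φ v
  refine hv ⟨i, ∑ c, r c • Module.finBasis F (V i) c, w, ?_⟩
  refine eq_of_evalAt_coord_eq (fun i => Module.finBasis F (V i)) fun p => ?_
  have h1 := hr (p i) p
  rw [Function.update_eq_self i (fun l => (Module.finBasis F (V l)).coord (p l))] at h1
  rw [h1, evalAt_tensorInsert,
    ← hw (Function.update (fun l => (Module.finBasis F (V l)).coord (p l)) i φ) (by simp)]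
  congr 1
  · simp [Finsupp.single_apply]
  · congr 1
    funext l
    have : (l : Fin k) ≠ i := l.2
    rw [Function.update_of_ne this]

theorem lt_of_mem_valueSupport {v : ⨂[F] i, V i} {Φ : ∀ i, ℕ → Module.Dual F (V i)}
    {N : ℕ} (hN : ∀ i n, N ≤ n → Φ i n = 0) {u : Fin k → ℕ} (hu : u ∈ valueSupport v Φ)
    (i : Fin k) : u i < N := by
  by_contra hi
  exact hu (MultilinearMap.map_coord_zero _ i (hN i _ (not_lt.1 hi)))

theorem exists_le_maximal_valueSupport {v : ⨂[F] i, V i} {Φ : ∀ i, ℕ → Module.Dual F (V i)}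
    {N : ℕ} (hN : ∀ i n, N ≤ n → Φ i n = 0) {u : Fin k → ℕ} (hu : u ∈ valueSupport v Φ) :
    ∃ γ, u ≤ γ ∧ Maximal (· ∈ valueSupport v Φ) γ := by
  refine Set.Finite.exists_le_maximal ?_ hu
  refine (Set.Finite.pi' (fun _ : Fin k => Set.finite_Iio N)).subset fun u hu i =>
    lt_of_mem_valueSupport hN hu i

/-- Placing one more functional `Φ i c - r • Φ i b` on top in direction `i`, where all maximal
points of the support have `i`-th coordinate `b`, makes direction `i` non-constant on the maximal
points provided the new row is nonzero and vanishes at some maximal point, and the projection of the set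
of maximal points to the other directions loses no point. -/
theorem exists_maximal_of_add_functional {v : ⨂[F] i, V i} {Φ : ∀ i, ℕ → Module.Dual F (V i)}
    {N : ℕ} (hN : ∀ i n, N ≤ n → Φ i n = 0) {i : Fin k} {m : Fin k → ℕ}
    (hm : Maximal (· ∈ valueSupport v Φ) m)
    (hconst : ∀ γ, Maximal (· ∈ valueSupport v Φ) γ → γ i = m i) {c : ℕ} {r : F}
    (hr : evalAt v (fun l => Φ l (Function.update m i c l)) = r * evalAt v (fun l => Φ l (m l)))
    {q : Fin k → ℕ} (hq : evalAt v (fun l => Φ l (Function.update q i c l)) ≠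
      r * evalAt v (fun l => Φ l (Function.update q i (m i) l))) :
    ∃ Φ' : ∀ i, ℕ → Module.Dual F (V i), (∀ i n, N + 1 ≤ n → Φ' i n = 0) ∧
      (∀ i n, n < N → Φ' i n = Φ i n) ∧
      (∃ γ γ', Maximal (· ∈ valueSupport v Φ') γ ∧ Maximal (· ∈ valueSupport v Φ') γ' ∧
        γ i ≠ γ' i) ∧
      ∀ γ, Maximal (· ∈ valueSupport v Φ) γ → ∃ γ', Maximal (· ∈ valueSupport v Φ') γ' ∧
        ∀ l, l ≠ i → γ' l = γ l := by
  classical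
  let Φ' : ∀ i, ℕ → Module.Dual F (V i) :=
    Function.update Φ i (Function.update (Φ i) N (Φ i c - r • Φ i (m i)))
  have hne : ∀ l, l ≠ i → Φ' l = Φ l := fun l hl => Function.update_of_ne hl _ _
  have hi : ∀ n, n ≠ N → Φ' i n = Φ i n := fun n hn => by simp [Φ', hn]
  have hiN : Φ' i N = Φ i c - r • Φ i (m i) := by simp [Φ']
  have hold : ∀ u : Fin k → ℕ, u i ≠ N →
      evalAt v (fun l => Φ' l (u l)) = evalAt v (fun l => Φ l (u l)) := fun u hu => by
    congr 1
    funext l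
    by_cases hl : l = i
    · subst hl
      exact hi _ hu
    · rw [hne l hl]
  have hnew : ∀ u : Fin k → ℕ, u i = N → evalAt v (fun l => Φ' l (u l)) =
      evalAt v (fun l => Φ l (Function.update u i c l)) -
        r * evalAt v (fun l => Φ l (Function.update u i (m i) l)) := fun u hu => by
    have h : ∀ n, (fun l => Φ l (Function.update u i n l)) =
        Function.update (fun l => Φ l (u l)) i (Φ i n) := fun n => by
      funext l
      by_cases hl : l = i
      · subst hl
        simp
      · simp [hl]
    have h' : (fun l => Φ' l (u l)) =
        Function.update (fun l => Φ l (u l)) i (Φ i c - r • Φ i (m i)) := by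
      funext l
      by_cases hl : l = i
      · subst hl
        rw [hu, hiN, Function.update_self]
      · rw [hne l hl, Function.update_of_ne hl]
    rw [h, h, h', MultilinearMap.map_update_sub, MultilinearMap.map_update_smul, smul_eq_mul]
  have hN' : ∀ i n, N + 1 ≤ n → Φ' i n = 0 := fun l n hn => by
    by_cases hl : l = i
    · subst hl
      rw [hi n (by omega), hN _ n (by omega)]
    · rw [hne l hl, hN _ n (by omega)]
  have hmN : ∀ {γ : Fin k → ℕ}, Maximal (· ∈ valueSupport v Φ) γ → γ i ≠ N := fun hγ =>
    (lt_of_mem_valueSupport hN hγ.prop i).ne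
  -- Points of the new row lie, away from direction `i`, below an old maximal point.
  have hbelow : ∀ u ∈ valueSupport v Φ', u i = N →
      ∃ γ, Maximal (· ∈ valueSupport v Φ) γ ∧ ∀ l, l ≠ i → u l ≤ γ l := fun u hu huN => by
    have key : ∃ n, Function.update u i n ∈ valueSupport v Φ := by
      by_contra! hcon
      refine hu ?_
      have h1 := hcon c
      have h2 := hcon (m i)
      simp only [valueSupport, Set.mem_ofPred_eq, not_not] at h1 h2
      rw [hnew u huN, h1, h2, mul_zero, sub_zero]
    obtain ⟨n, hn⟩ := key
    obtain ⟨γ, hle, hγ⟩ := exists_le_maximal_valueSupport hN hn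
    refine ⟨γ, hγ, fun l hl => ?_⟩
    simpa [hl] using hle l
  have hlift : ∀ γ, Maximal (· ∈ valueSupport v Φ) γ → ∃ γ',
      Maximal (· ∈ valueSupport v Φ') γ' ∧ (∀ l, l ≠ i → γ' l = γ l) := fun γ hγ => by
    have hγ' : γ ∈ valueSupport v Φ' := by
      have := hγ.prop
      rwa [valueSupport, Set.mem_ofPred_eq, hold γ (hmN hγ)]
    obtain ⟨γ', hle, hmax⟩ := exists_le_maximal_valueSupport hN' hγ'
    refine ⟨γ', hmax, fun l hl => ?_⟩
    -- If `γ'` is in the new row, it is squeezed between `γ` and an old maximal point `δ ≥ γ`.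
    by_cases hγN : γ' i = N
    · obtain ⟨δ, hδ, hδle⟩ := hbelow γ' hmax.prop hγN
      have hγδ : γ ≤ δ := fun l' => by
        by_cases hl' : l' = i
        · subst hl'
          rw [hconst γ hγ, hconst δ hδ]
        · exact (hle l').trans (hδle l' hl')
      have : δ ≤ γ := hγ.le_of_ge hδ.prop hγδ
      exact le_antisymm ((hδle l hl).trans (this l)) (hle l)
    · have hmem : γ' ∈ valueSupport v Φ := by
        have := hmax.prop
        rwa [valueSupport, Set.mem_ofPred_eq, hold γ' hγN] at this
      exact le_antisymm (hγ.le_of_ge hmem hle l) (hle l)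
  refine ⟨Φ', hN', fun l n hn => ?_, ?_, hlift⟩
  · by_cases hl : l = i
    · subst hl
      exact hi n hn.ne
    · rw [hne l hl]
  have hq' : Function.update q i N ∈ valueSupport v Φ' := by
    rw [valueSupport, Set.mem_ofPred_eq, hnew _ (by simp), sub_ne_zero]
    simpa using hq
  obtain ⟨γ, hle, hγ⟩ := exists_le_maximal_valueSupport hN' hq'
  obtain ⟨γ', hγ', hagree⟩ := hlift m hm
  refine ⟨γ, γ', hγ, hγ', ?_⟩
  have h1 : γ i = N := by
    have := lt_of_mem_valueSupport hN' hγ.prop i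
    have := hle i
    simp only [Function.update_self] at this
    omega
  rw [h1]
  intro h2
  refine hγ'.prop ?_
  have hupd : ∀ n, Function.update γ' i n = Function.update m i n := fun n => by
    funext l
    by_cases hl : l = i
    · subst hl
      simp
    · simp [hl, hagree l hl]
  rw [hnew γ' h2.symm, hupd, hupd, hr, Function.update_eq_self, sub_self]

/-- A tensor which is not a slice has, with respect to suitable ordered families of functionals,
a support whose maximal points do not all agree in any coordinate. -/
theorem exists_functionals_maximal_ne [∀ i, FiniteDimensional F (V i)] {v : ⨂[F] i, V i}
    (hv : ¬ IsSliceTensor v) :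
    ∃ (N : ℕ) (Φ : ∀ i, Fin N → Module.Dual F (V i)), ∀ i, ∃ γ γ',
      Maximal (· ∈ valueSupport v Φ) γ ∧ Maximal (· ∈ valueSupport v Φ) γ' ∧ γ i ≠ γ' i := by
  classical
  -- The directions are treated one at a time. Keeping the coordinate functionals among the `Φ i`
  -- makes sure that the whole of `v` stays visible; the value `0` beyond `N` leaves room for more.
  have main : ∀ S : Finset (Fin k), ∃ (N : ℕ) (Φ : ∀ i, ℕ → Module.Dual F (V i)),
      (∀ i n, N ≤ n → Φ i n = 0) ∧
      (∀ i (a : Fin (Module.finrank F (V i))),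
        (a : ℕ) < N ∧ Φ i a = (Module.finBasis F (V i)).coord a) ∧
      ∀ i ∈ S, ∃ γ γ', Maximal (· ∈ valueSupport v Φ) γ ∧
        Maximal (· ∈ valueSupport v Φ) γ' ∧ γ i ≠ γ' i := by
    intro S
    induction S using Finset.induction_on with
    | empty =>
      refine ⟨∑ i, Module.finrank F (V i), fun i n =>
        if h : n < Module.finrank F (V i) then (Module.finBasis F (V i)).coord ⟨n, h⟩ else 0,
        fun i n hn => ?_, fun i a => ⟨?_, by simp⟩, by simp⟩
      · refine dif_neg ?_
        have := Finset.single_le_sum (f := fun i => Module.finrank F (V i))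
          (fun _ _ => Nat.zero_le _) (Finset.mem_univ i)
        omega
      · exact a.2.trans_le (Finset.single_le_sum (f := fun i => Module.finrank F (V i))
          (fun _ _ => Nat.zero_le _) (Finset.mem_univ i))
    | insert i S hiS ih =>
      obtain ⟨N, Φ, hN, hcoord, hS⟩ := ih
      by_cases hex : ∃ γ γ', Maximal (· ∈ valueSupport v Φ) γ ∧
          Maximal (· ∈ valueSupport v Φ) γ' ∧ γ i ≠ γ' i
      · refine ⟨N, Φ, hN, hcoord, fun l hl => ?_⟩
        rcases Finset.mem_insert.1 hl with rfl | hl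
        · exact hex
        · exact hS l hl
      push Not at hex
      have hupd : ∀ (p : ∀ l, Fin (Module.finrank F (V l))) (n : ℕ),
          (fun l => Φ l (Function.update (fun l => (p l : ℕ)) i n l)) =
          Function.update (fun l => (Module.finBasis F (V l)).coord (p l)) i (Φ i n) :=
        fun p n => by
          funext l
          by_cases hl : l = i
          · subst hl
            simp
          · simp [hl, (hcoord l (p l)).2]
      have hne : ∃ u, u ∈ valueSupport v Φ := by
        obtain ⟨c, hc⟩ := exists_coord_not_proportional hv i 0
        obtain ⟨p, hp⟩ := hc 0
        refine ⟨Function.update (fun l => (p l : ℕ)) i c, ?_⟩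
        rw [valueSupport, Set.mem_ofPred_eq, hupd, (hcoord i c).2]
        simpa using hp
      obtain ⟨u, hu⟩ := hne
      obtain ⟨m, -, hm⟩ := exists_le_maximal_valueSupport hN hu
      obtain ⟨c, hc⟩ := exists_coord_not_proportional hv i (Φ i (m i))
      -- This ratio makes the new row vanish at `m`.
      obtain ⟨p, hp⟩ := hc (evalAt v (fun l => Φ l (Function.update m i c l)) /
        evalAt v (fun l => Φ l (m l)))
      obtain ⟨Φ', hN', hlow, hi, hlift⟩ := exists_maximal_of_add_functional hN hm
        (fun γ hγ => hex γ m hγ hm) (c := c) (div_mul_cancel₀ _ hm.prop).symm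
        (q := fun l => (p l : ℕ)) (by rw [hupd, hupd, (hcoord i c).2]; exact hp)
      refine ⟨N + 1, Φ', hN', fun l a => ⟨(hcoord l a).1.trans (Nat.lt_succ_self N), ?_⟩,
        fun l hl => ?_⟩
      · rw [hlow l a (hcoord l a).1, (hcoord l a).2]
      rcases Finset.mem_insert.1 hl with rfl | hl
      · exact hi
      · have hli : l ≠ i := fun h => hiS (h ▸ hl)
        obtain ⟨γ, γ', hγ, hγ', hne⟩ := hS l hl
        obtain ⟨δ, hδ, hδγ⟩ := hlift γ hγ
        obtain ⟨δ', hδ', hδγ'⟩ := hlift γ' hγ'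
        exact ⟨δ, δ', hδ, hδ', by rwa [hδγ l hli, hδγ' l hli]⟩
  obtain ⟨N, Φ, hN, -, hΦ⟩ := main Finset.univ
  refine ⟨N, fun i a => Φ i a, fun i => ?_⟩
  have hfin : ∀ γ, Maximal (· ∈ valueSupport v Φ) γ → ∃ δ : Fin k → Fin N,
      Maximal (· ∈ valueSupport v (fun i (a : Fin N) => Φ i a)) δ ∧ ∀ l, (δ l : ℕ) = γ l :=
    fun γ hγ => ⟨fun l => ⟨γ l, lt_of_mem_valueSupport hN hγ.prop l⟩,
      ⟨hγ.prop, fun δ hδ hle => hγ.le_of_ge (y := fun l => (δ l : ℕ)) hδ hle⟩, fun l => rfl⟩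
  obtain ⟨γ, γ', hγ, hγ', hne⟩ := hΦ i (Finset.mem_univ i)
  obtain ⟨δ, hδ, h⟩ := hfin γ hγ
  obtain ⟨δ', hδ', h'⟩ := hfin γ' hγ'
  refine ⟨δ, δ', hδ, hδ', fun heq => hne ?_⟩
  rw [← h, ← h', heq]

end MaximalPoints

/-! ### Counting rearrangements of balanced words -/

section Counting

open scoped Nat

/-- Two maximal points of a set in a product of `k` chains which differ in one coordinate differ in
a second one. Hence `k` maximal points suffice to see every coordinate vary. -/
theorem exists_family_maximal_nonconst {k : ℕ} (hk : 1 ≤ k) {I : Type*} [LinearOrder I]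
    {S : Set (Fin k → I)}
    (h : ∀ i, ∃ γ γ', Maximal (· ∈ S) γ ∧ Maximal (· ∈ S) γ' ∧ γ i ≠ γ' i) :
    2 ≤ k ∧ ∃ g : Fin k → Fin k → I, (∀ c, Maximal (· ∈ S) (g c)) ∧
      ∀ i, ∃ c c', g c i ≠ g c' i := by
  classical
  obtain ⟨γ, γ', hγ, hγ', hne⟩ := h ⟨0, hk⟩
  set o : Fin k := ⟨0, hk⟩
  have hj : ∃ j, j ≠ o ∧ γ j ≠ γ' j := by
    by_contra! hcon
    rcases le_total (γ o) (γ' o) with hle | hle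
    · have : γ ≤ γ' := fun l => by
        by_cases hl : l = o
        · rw [hl]; exact hle
        · exact (hcon l hl).le
      exact hne (le_antisymm hle (hγ.le_of_ge hγ'.prop this o))
    · have : γ' ≤ γ := fun l => by
        by_cases hl : l = o
        · rw [hl]; exact hle
        · exact (hcon l hl).ge
      exact hne (le_antisymm (hγ'.le_of_ge hγ.prop this o) hle)
  obtain ⟨j, hjo, hj⟩ := hj
  have hother : ∀ i, ∃ δ, Maximal (· ∈ S) δ ∧ δ i ≠ γ i := fun i => by
    obtain ⟨δ, δ', hδ, hδ', hne⟩ := h i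
    by_cases hi : δ i = γ i
    · exact ⟨δ', hδ', fun h => hne (hi.trans h.symm)⟩
    · exact ⟨δ, hδ, hi⟩
  choose δ hδ hδne using hother
  refine ⟨?_, fun c => if c = o then γ else if c = j then γ' else δ c, fun c => ?_, fun i => ?_⟩
  · have : (j : ℕ) ≠ 0 := fun h => hjo (Fin.ext h)
    have := j.2
    omega
  · dsimp only
    split_ifs
    exacts [hγ, hγ', hδ c]
  · by_cases hio : i = o
    · exact ⟨o, j, by simpa [hjo, hio] using hne⟩
    · by_cases hij : i = j
      · exact ⟨o, j, by simpa [hjo, hij] using hj⟩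
      · exact ⟨i, o, by simpa [hio, hij] using hδne i⟩

theorem choose_le_choose_of_le_of_add_le {n m a : ℕ} (hma : m ≤ a) (han : a + m ≤ n) :
    n.choose m ≤ n.choose a := by
  have half : ∀ b, m ≤ b → b ≤ n / 2 → n.choose m ≤ n.choose b := fun b hmb => by
    induction b, hmb using Nat.le_induction with
    | base => exact fun _ => le_rfl
    | succ b _ ih =>
      exact fun hb => (ih (by omega)).trans (Nat.choose_le_succ_of_lt_half_left (by omega))
  by_cases ha : a ≤ n / 2
  · exact half a hma ha
  · rw [← Nat.choose_symm (by omega : a ≤ n)]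
    exact half _ (by omega) (by omega)

/-- The number of rearrangements of a word `f` which give a fixed word is at most `m! (n - m)!`,
if some letter of `f` occurs at least `m` times and at most `n - m` times. -/
theorem card_perm_comp_eq_mul_choose_le {n m : ℕ} {I : Type*} [DecidableEq I] (f f' : Fin n → I)
    (x : I) (hx : m ≤ Fintype.card {l // f l = x}) (hx' : Fintype.card {l // f l = x} + m ≤ n) :
    (Finset.univ.filter fun σ : Equiv.Perm (Fin n) => f ∘ σ = f').card * n.choose m ≤ n ! := by
  rcases (Finset.univ.filter fun σ : Equiv.Perm (Fin n) => f ∘ σ = f').eq_empty_or_nonempty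
    with h | ⟨τ, hτ⟩
  · rw [h, Finset.card_empty, zero_mul]
    exact Nat.zero_le _
  have hτ' : f ∘ τ = f' := by simpa using hτ
  set a := Fintype.card {l // f l = x}
  have hcard : (Finset.univ.filter fun σ : Equiv.Perm (Fin n) => f ∘ σ = f').card ≤
      Fintype.card {σ : Equiv.Perm (Fin n) // f ∘ σ = f} := by
    rw [Fintype.card_subtype]
    refine Finset.card_le_card_of_injOn (fun σ => σ * τ⁻¹) (fun σ hσ => ?_)
      (fun σ _ σ' _ h => mul_right_cancel h)
    have hσ' : f ∘ σ = f ∘ τ := by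
      rw [hτ']
      simpa using hσ
    simp only [Finset.coe_filter, Finset.mem_univ, true_and, Set.mem_ofPred_eq]
    funext l
    simpa using congrFun hσ' (τ⁻¹ l)
  have hstab : Fintype.card {σ : Equiv.Perm (Fin n) // f ∘ σ = f} ≤ a ! * (n - a)! := by
    rw [DomMulAct.stabilizer_card']
    have hsum : ∀ s : Finset I, (∀ y, y ∉ s → ∀ l, f l ≠ y) →
        ∑ y ∈ s, Fintype.card {l // f l = y} = n := fun s hs => by
      simp only [Fintype.card_subtype]
      rw [← Finset.card_eq_sum_card_fiberwise (s := Finset.univ) (f := f) (t := s)]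
      · simp
      · intro l _
        by_contra hl
        exact hs _ hl l rfl
    -- The letter `x` need not occur when `m = 0`, hence the `insert`.
    have hsub : ∏ y ∈ Finset.univ.image f, (Fintype.card {l // f l = y})! ≤
        ∏ y ∈ insert x (Finset.univ.image f), (Fintype.card {l // f l = y})! :=
      Finset.prod_le_prod_of_subset_of_one_le' (Finset.subset_insert _ _)
        fun y _ _ => Nat.one_le_iff_ne_zero.2 (Nat.factorial_ne_zero _)
    refine hsub.trans ?_
    have hins := Finset.mem_insert_self x (Finset.univ.image f)
    rw [← Finset.mul_prod_erase _ _ hins]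
    refine Nat.mul_le_mul_left _ ?_
    refine (Nat.le_of_dvd (Nat.factorial_pos _)
      (Nat.prod_factorial_dvd_factorial_sum _ _)).trans_eq ?_
    congr 1
    have := hsum (insert x (Finset.univ.image f)) fun y hy l hl => hy (by simp [← hl])
    rw [← Finset.add_sum_erase _ _ hins] at this
    omega
  calc _ ≤ (a ! * (n - a)!) * n.choose a :=
        Nat.mul_le_mul (hcard.trans hstab) (choose_le_choose_of_le_of_add_le hx hx')
    _ = n ! := by
        rw [mul_comm, ← mul_assoc]
        exact Nat.choose_mul_factorial_mul_factorial (by omega)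

/-- The periodic word `0 1 ⋯ (k - 1) 0 1 ⋯` of length `n` contains each letter at least `n / k`
times. -/
theorem div_le_card_mod_eq {k : ℕ} (n : ℕ) (c : Fin k) :
    n / k ≤ Fintype.card {l : Fin n // (l : ℕ) % k = c} := by
  have hlt : ∀ t : Fin (n / k), k * t + c < n := fun t => by
    calc k * t + c < k * t + k := Nat.add_lt_add_left c.2 _
      _ = k * (t + 1) := by ring
      _ ≤ k * (n / k) := Nat.mul_le_mul_left _ t.2
      _ ≤ n := Nat.mul_div_le n k
  have := Fintype.card_le_of_injective
    (fun t : Fin (n / k) => (⟨⟨k * t + c, hlt t⟩, by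
      simp [Nat.add_mod, Nat.mod_eq_of_lt c.2]⟩ : {l : Fin n // (l : ℕ) % k = c}))
    (fun t t' h => by
      have hk : 0 < k := c.pos
      have h' : k * (t : ℕ) + c = k * t' + c := by simpa using h
      exact Fin.ext (Nat.eq_of_mul_eq_mul_left hk (Nat.add_right_cancel h')))
  simpa using this

/-- In a lexicographically ordered power, words in maximal points of the support are maximal. -/
theorem maximal_toLex_of_forall_maximal {k n : ℕ} {I : Type*} [LinearOrder I]
    {S : Set (Fin k → I)} {u : Fin n → Fin k → I} (hu : ∀ l, Maximal (· ∈ S) (u l)) :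
    Maximal (fun p : Fin k → Lex (Fin n → I) => ∀ l, (fun i => ofLex (p i) l) ∈ S)
      (fun i => toLex fun l => u l i) := by
  refine ⟨fun l => (hu l).prop, fun p hp hle => ?_⟩
  have heq : ∀ l, (fun i => ofLex (p i) l) = u l := fun l => by
    induction l using WellFoundedLT.induction with
    | ind l ih =>
      have hge : u l ≤ fun i => ofLex (p i) l := fun i =>
        Pi.apply_le_of_toLex (x := fun l => u l i) (y := ofLex (p i)) (hle i)
          fun l' hl' => (congrFun (ih l' hl') i).symm
      exact le_antisymm ((hu l).le_of_ge (hp l) hge) hge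
  intro i
  refine le_of_eq ?_
  change p i = toLex fun l => u l i
  rw [← toLex_ofLex (p i)]
  congr 1
  funext l
  exact congrFun (heq l) i

/-- The slice rank of the `n`-th power of a tensor which is not a slice is at least the binomial
coefficient `n.choose (n / k)`. -/
theorem choose_div_le_sliceRank {F : Type*} [Field F] {k : ℕ} (hk : 1 ≤ k) {V : Fin k → Type*}
    [∀ i, AddCommGroup (V i)] [∀ i, Module F (V i)] [∀ i, FiniteDimensional F (V i)]
    {v : ⨂[F] i, V i} (hv : ¬ IsSliceTensor v) (n : ℕ) :
    2 ≤ k ∧ n.choose (n / k) ≤ sliceRank (kTensorPow v n) := by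
  classical
  obtain ⟨N, Φ, hΦ⟩ := exists_functionals_maximal_ne hv
  obtain ⟨hk2, g, hg, hgne⟩ := exists_family_maximal_nonconst hk hΦ
  refine ⟨hk2, ?_⟩
  obtain ⟨c, s, hs, hsum⟩ := sliceRank_spec hk (kTensorPow v n)
  obtain ⟨B, hB, hcover⟩ := exists_cover_of_sum_slices
    (I := fun _ : Fin k => Lex (Fin n → Fin N))
    (fun i p => powerFunctional fun l => Φ i (ofLex p l)) c s hs
  rw [← hsum] at hcover
  let ω : Fin n → Fin k := fun l => ⟨(l : ℕ) % k, Nat.mod_lt _ hk⟩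
  let f : ∀ i : Fin k, Fin n → Fin N := fun i l => g (ω l) i
  have hsupp : (fun p : Fin k → Lex (Fin n → Fin N) => evalAt (kTensorPow v n)
      (fun i => powerFunctional fun l => Φ i (ofLex (p i) l)) ≠ 0) =
      fun p : Fin k → Lex (Fin n → Fin N) =>
        ∀ l, (fun i => ofLex (p i) l) ∈ valueSupport v Φ := by
    funext p
    rw [evalAt_kTensorPow, Finset.prod_ne_zero_iff]
    simp [valueSupport]
  rw [hsupp] at hcover
  -- Every rearrangement of the periodic word in the points `g c` is covered.
  have hmem : ∀ σ : Equiv.Perm (Fin n), ∃ i, toLex (f i ∘ σ) ∈ B i := fun σ =>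
    hcover _ (maximal_toLex_of_forall_maximal (u := fun l => g (ω (σ l))) fun l => hg _)
  have hfib : ∀ (i : Fin k) (p : Fin n → Fin N),
      (Finset.univ.filter fun σ : Equiv.Perm (Fin n) => f i ∘ σ = p).card * n.choose (n / k) ≤
        n ! := fun i p => by
    obtain ⟨a, b, hab⟩ := hgne i
    have hω : ∀ (e : Fin k) (l : Fin n), (l : ℕ) % k = e → f i l = g e i := fun e l hl => by
      have : ω l = e := Fin.ext hl
      simp only [f, this]
    refine card_perm_comp_eq_mul_choose_le (f i) p (g a i) ?_ ?_
    · refine (div_le_card_mod_eq n a).trans ?_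
      exact Fintype.card_subtype_mono _ _ fun l hl => hω a l hl
    · have hne : ∀ l : Fin n, (l : ℕ) % k = b → ¬ f i l = g a i := fun l hl h =>
        hab (h.symm.trans (hω b l hl))
      have h1 : n / k ≤ Fintype.card {l // ¬ f i l = g a i} :=
        (div_le_card_mod_eq n b).trans (Fintype.card_subtype_mono _ _ hne)
      rw [Fintype.card_subtype_compl, Fintype.card_fin] at h1
      have h2 := Fintype.card_subtype_le fun l => f i l = g a i
      rw [Fintype.card_fin] at h2
      omega
  have hcount : n ! ≤ ∑ i, ∑ p ∈ B i,
      (Finset.univ.filter fun σ : Equiv.Perm (Fin n) => f i ∘ σ = ofLex p).card := by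
    calc n ! = (Finset.univ : Finset (Equiv.Perm (Fin n))).card := by
          rw [Finset.card_univ, Fintype.card_perm, Fintype.card_fin]
      _ ≤ (Finset.univ.biUnion fun i => (B i).biUnion fun p =>
          Finset.univ.filter fun σ : Equiv.Perm (Fin n) => f i ∘ σ = ofLex p).card := by
          refine Finset.card_le_card fun σ _ => ?_
          obtain ⟨i, hi⟩ := hmem σ
          simp only [Finset.mem_biUnion, Finset.mem_filter, Finset.mem_univ, true_and]
          exact ⟨i, _, hi, rfl⟩
      _ ≤ _ := Finset.card_biUnion_le.trans
          (Finset.sum_le_sum fun i _ => Finset.card_biUnion_le)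
  have hmul : n ! * n.choose (n / k) ≤ n ! * sliceRank (kTensorPow v n) := by
    calc n ! * n.choose (n / k)
        ≤ (∑ i, ∑ p ∈ B i, (Finset.univ.filter fun σ : Equiv.Perm (Fin n) =>
            f i ∘ σ = ofLex p).card) * n.choose (n / k) := Nat.mul_le_mul_right _ hcount
      _ ≤ ∑ i, ∑ p ∈ B i, n ! := by
          rw [Finset.sum_mul]
          refine Finset.sum_le_sum fun i _ => ?_
          rw [Finset.sum_mul]
          exact Finset.sum_le_sum fun p _ => hfib i (ofLex p)
      _ = n ! * ∑ i, (B i).card := by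
          simp only [Finset.sum_const, smul_eq_mul, Finset.mul_sum, mul_comm]
      _ ≤ _ := Nat.mul_le_mul_left _ hB
  exact Nat.le_of_mul_le_mul_left hmul (Nat.factorial_pos n)

end Counting

/-! ### Growth of the binomial coefficients -/

section Asymptotics

/-- The largest term of the binomial expansion of `(1 + q) ^ ((q + 1) * m)` is the one with
index `m`. -/
theorem choose_mul_pow_le_choose_mul_pow (q m j : ℕ) (hj : j ≤ (q + 1) * m) :
    ((q + 1) * m).choose j * q ^ ((q + 1) * m - j) ≤ ((q + 1) * m).choose m * q ^ (q * m) := by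
  set n := (q + 1) * m with hn
  have hqm : q * m = n - m := by rw [hn, add_mul, one_mul, Nat.add_sub_cancel]
  have hmn : m ≤ n := by rw [hn]; exact Nat.le_mul_of_pos_left _ (Nat.succ_pos q)
  rw [hqm]
  have hpow : ∀ i, i < n → q ^ (n - i) = q * q ^ (n - (i + 1)) := fun i hi => by
    rw [← pow_succ', show n - (i + 1) + 1 = n - i by omega]
  have hnm : n = q * m + m := by rw [hn]; ring
  have up : ∀ i, i < m → n.choose i * q ^ (n - i) ≤ n.choose (i + 1) * q ^ (n - (i + 1)) :=
    fun i hi => by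
      rw [hpow i (by omega), ← mul_assoc]
      refine Nat.mul_le_mul_right _ (Nat.le_of_mul_le_mul_right ?_ (Nat.succ_pos i))
      rw [Nat.succ_eq_add_one, Nat.choose_succ_right_eq, mul_assoc]
      refine Nat.mul_le_mul_left _ ?_
      have : q * (i + 1) ≤ q * m := Nat.mul_le_mul_left _ hi
      omega
  have down : ∀ i, m ≤ i → i < n →
      n.choose (i + 1) * q ^ (n - (i + 1)) ≤ n.choose i * q ^ (n - i) :=
    fun i hi hin => by
      rw [hpow i hin, ← mul_assoc]
      refine Nat.mul_le_mul_right _ (Nat.le_of_mul_le_mul_right ?_ (Nat.succ_pos i))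
      rw [Nat.succ_eq_add_one, Nat.choose_succ_right_eq, mul_assoc]
      refine Nat.mul_le_mul_left _ ?_
      have : q * m ≤ q * (i + 1) := Nat.mul_le_mul_left _ (by omega)
      omega
  rcases le_total j m with h | h
  · exact Nat.decreasingInduction' (P := fun i => n.choose i * q ^ (n - i) ≤
      n.choose m * q ^ (n - m)) (fun i hi _ ih => (up i hi).trans ih) h le_rfl
  · clear up
    induction j, h using Nat.le_induction with
    | base => exact le_rfl
    | succ i hi ih => exact (down i hi (by omega)).trans (ih (by omega))

theorem pow_le_mul_choose_mul_pow (q m : ℕ) :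
    (q + 1) ^ ((q + 1) * m) ≤ ((q + 1) * m + 1) * (((q + 1) * m).choose m * q ^ (q * m)) := by
  calc (q + 1) ^ ((q + 1) * m)
      = ∑ j ∈ Finset.range ((q + 1) * m + 1),
          ((q + 1) * m).choose j * q ^ ((q + 1) * m - j) := by
        rw [add_comm q 1, add_pow]
        exact Finset.sum_congr rfl fun j _ => by rw [one_pow, one_mul, Nat.cast_id, mul_comm]
    _ ≤ ∑ j ∈ Finset.range ((q + 1) * m + 1), ((q + 1) * m).choose m * q ^ (q * m) :=
        Finset.sum_le_sum fun j hj =>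
          choose_mul_pow_le_choose_mul_pow q m j (by simpa [Nat.lt_succ_iff] using hj)
    _ = _ := by rw [Finset.sum_const, Finset.card_range, smul_eq_mul]

theorem one_lt_sliceGap {k : ℕ} (hk : 2 ≤ k) : 1 < sliceGap k := by
  have hk' : (2 : ℝ) ≤ k := by exact_mod_cast hk
  have h0 : (0 : ℝ) < (k : ℝ) - 1 := by linarith
  rw [sliceGap, one_lt_div (Real.rpow_pos_of_pos h0 _)]
  calc ((k : ℝ) - 1) ^ (((k : ℝ) - 1) / (k : ℝ)) ≤ ((k : ℝ) - 1) ^ (1 : ℝ) :=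
        Real.rpow_le_rpow_of_exponent_le (by linarith) (by rw [div_le_one] <;> linarith)
    _ = (k : ℝ) - 1 := Real.rpow_one _
    _ < k := by linarith

theorem sliceGap_pow_mul (q m : ℕ) :
    sliceGap (q + 1) ^ ((q + 1) * m) = ((q : ℝ) + 1) ^ ((q + 1) * m) / (q : ℝ) ^ (q * m) := by
  have hq : (0 : ℝ) ≤ q := Nat.cast_nonneg q
  have hq1 : (q : ℝ) + 1 ≠ 0 := by positivity
  rw [sliceGap, div_pow]
  push_cast
  rw [add_sub_cancel_right, ← Real.rpow_natCast ((q : ℝ) ^ _), ← Real.rpow_mul hq]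
  congr 1
  rw [← Real.rpow_natCast]
  congr 1
  push_cast
  field_simp

theorem sliceGap_pow_div_le_choose {k : ℕ} (hk : 2 ≤ k) (n : ℕ) :
    sliceGap k ^ ((n : ℝ) - k) / (n + 1) ≤ (n.choose (n / k) : ℝ) := by
  -- With `m = n / k`, the coefficient is compared to the one with upper index `k * m ≤ n`.
  obtain ⟨q, rfl⟩ : ∃ q, k = q + 1 := ⟨k - 1, by omega⟩
  set m := n / (q + 1) with hm
  have hle : (q + 1) * m ≤ n := Nat.mul_div_le n (q + 1)
  have hlt : n < (q + 1) * m + (q + 1) := by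
    have := Nat.lt_mul_div_succ n (Nat.succ_pos q)
    rw [Nat.succ_eq_add_one, ← hm] at this
    linarith
  have hq : (0 : ℝ) < q := by
    have : 0 < q := by omega
    exact_mod_cast this
  have hbin : sliceGap (q + 1) ^ ((q + 1) * m) ≤
      (((q + 1) * m : ℕ) + 1 : ℝ) * (((q + 1) * m).choose m : ℝ) := by
    rw [sliceGap_pow_mul, div_le_iff₀ (by positivity), mul_assoc]
    exact_mod_cast pow_le_mul_choose_mul_pow q m
  rw [div_le_iff₀ (by positivity)]
  calc sliceGap (q + 1) ^ ((n : ℝ) - (q + 1 : ℕ))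
      ≤ sliceGap (q + 1) ^ ((((q + 1) * m : ℕ) : ℝ)) := by
        refine Real.rpow_le_rpow_of_exponent_le (one_lt_sliceGap hk).le ?_
        have : (n : ℝ) < (((q + 1) * m : ℕ) : ℝ) + ((q + 1 : ℕ) : ℝ) := by exact_mod_cast hlt
        linarith
    _ = sliceGap (q + 1) ^ ((q + 1) * m) := Real.rpow_natCast _ _
    _ ≤ _ := hbin
    _ ≤ ((n : ℝ) + 1) * (n.choose m : ℝ) := by
        have h1 : (((q + 1) * m : ℕ) : ℝ) ≤ n := by exact_mod_cast hle
        have h2 : (((q + 1) * m).choose m : ℝ) ≤ n.choose m := by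
          exact_mod_cast Nat.choose_le_choose m hle
        gcongr
    _ = _ := mul_comm _ _

theorem isLittleO_neg_const_sub_log_div (a b : ℝ) :
    (fun n : ℕ => -a - Real.log ((n : ℝ) + 1) / b) =o[atTop] (fun n : ℕ => (n : ℝ)) := by
  have hlog : (fun n : ℕ => Real.log ((n : ℝ) + 1)) =o[atTop] (fun n : ℕ => (n : ℝ)) := by
    have h1 : (fun n : ℕ => Real.log ((n : ℝ) + 1)) =o[atTop] (fun n : ℕ => (n : ℝ) + 1) :=
      Real.isLittleO_log_id_atTop.comp_tendsto
        (tendsto_natCast_atTop_atTop.atTop_add tendsto_const_nhds)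
    refine h1.trans_isBigO ?_
    refine IsBigO.of_bound 2 ?_
    filter_upwards [eventually_ge_atTop 1] with n hn
    have : (1 : ℝ) ≤ n := by exact_mod_cast hn
    rw [Real.norm_of_nonneg (by positivity), Real.norm_of_nonneg (by positivity)]
    linarith
  have hconst : (fun _ : ℕ => -a) =o[atTop] (fun n : ℕ => (n : ℝ)) :=
    isLittleO_const_left.2 (Or.inr (tendsto_norm_atTop_atTop.comp tendsto_natCast_atTop_atTop))
  simpa only [div_eq_inv_mul] using hconst.sub (hlog.const_mul_left b⁻¹)

theorem sliceGap_three_bounds : 1.889 < sliceGap 3 ∧ sliceGap 3 < 1.890 := by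
  have hpos : 0 < sliceGap 3 := zero_lt_one.trans (one_lt_sliceGap (by norm_num))
  have hcube : sliceGap 3 ^ 3 = 27 / 4 := by
    have := sliceGap_pow_mul 2 1
    norm_num at this
    exact this
  constructor
  · refine lt_of_pow_lt_pow_left₀ 3 hpos.le ?_
    rw [hcube]
    norm_num
  · refine lt_of_pow_lt_pow_left₀ 3 (by norm_num) ?_
    rw [hcube]
    norm_num

end Asymptotics

/-! ### The gap in the asymptotic slice rank -/

theorem mainTheorem1 {F : Type*} [Field F] {k : ℕ} (hk : 1 ≤ k) {V : Fin k → Type*}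
    [∀ i, AddCommGroup (V i)] [∀ i, Module F (V i)] [∀ i, FiniteDimensional F (V i)]
    (v : ⨂[F] i, V i) :
    (¬ IsSliceTensor v →
      ∃ e : ℕ → ℝ, e =o[atTop] (fun n : ℕ => (n : ℝ)) ∧
        ∀ n : ℕ, sliceGap k ^ ((n : ℝ) + e n) ≤ (sliceRank (kTensorPow v n) : ℝ)) ∧
    (v ≠ 0 →
      (IsSliceTensor v ∧ lowerAsymptoticSliceRank v = 1 ∧ upperAsymptoticSliceRank v = 1) ∨
      (¬ IsSliceTensor v ∧ ((sliceGap k : ℝ) : EReal) ≤ lowerAsymptoticSliceRank v)) ∧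
    (1.889 < sliceGap 3 ∧ sliceGap 3 < 1.890) := by
  have part1 : ¬ IsSliceTensor v → 2 ≤ k ∧
      ∃ e : ℕ → ℝ, e =o[atTop] (fun n : ℕ => (n : ℝ)) ∧
        ∀ n : ℕ, sliceGap k ^ ((n : ℝ) + e n) ≤ (sliceRank (kTensorPow v n) : ℝ) := by
    intro hv
    have hk2 : 2 ≤ k := (choose_div_le_sliceRank hk hv 0).1
    have hgap := one_lt_sliceGap hk2
    have hpos : 0 < sliceGap k := zero_lt_one.trans hgap
    -- This error term turns the bound `sliceGap k ^ (n - k) / (n + 1)` into a single power.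
    refine ⟨hk2, fun n => -(k : ℝ) - Real.log ((n : ℝ) + 1) / Real.log (sliceGap k),
      isLittleO_neg_const_sub_log_div _ _, fun n => ?_⟩
    have hlog : sliceGap k ^ (Real.log ((n : ℝ) + 1) / Real.log (sliceGap k)) = (n : ℝ) + 1 := by
      rw [Real.rpow_def_of_pos hpos, mul_div_cancel₀ _ (Real.log_pos hgap).ne',
        Real.exp_log (by positivity)]
    calc sliceGap k ^ ((n : ℝ) + (-(k : ℝ) - Real.log ((n : ℝ) + 1) / Real.log (sliceGap k)))
        = sliceGap k ^ ((n : ℝ) - k) / (n + 1) := by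
          rw [← add_sub_assoc, Real.rpow_sub hpos, hlog, ← sub_eq_add_neg]
      _ ≤ (n.choose (n / k) : ℝ) := sliceGap_pow_div_le_choose hk2 n
      _ ≤ _ := by exact_mod_cast (choose_div_le_sliceRank hk hv n).2
  refine ⟨fun hv => (part1 hv).2, fun hv0 => ?_, sliceGap_three_bounds⟩
  by_cases hv : IsSliceTensor v
  · have hone : ∀ n : ℕ,
        (((sliceRank (kTensorPow v n) : ℝ) ^ (1 / (n : ℝ)) : ℝ) : EReal) = 1 := fun n => by
      rw [(hv.kTensorPow n).sliceRank_eq_one hk (kTensorPow_ne_zero hv0 n), Nat.cast_one,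
        Real.one_rpow, EReal.coe_one]
    refine Or.inl ⟨hv, ?_, ?_⟩
    · simp only [lowerAsymptoticSliceRank, hone, liminf_const]
    · simp only [upperAsymptoticSliceRank, hone, limsup_const]
  · refine Or.inr ⟨hv, ?_⟩
    obtain ⟨hk2, e, he, hle⟩ := part1 hv
    have hpos : 0 < sliceGap k := zero_lt_one.trans (one_lt_sliceGap hk2)
    have hlim : Tendsto (fun n : ℕ => sliceGap k ^ (1 + e n / n)) atTop (𝓝 (sliceGap k)) := by
      have h1 : Tendsto (fun n : ℕ => 1 + e n / n) atTop (𝓝 (1 + 0)) :=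
        tendsto_const_nhds.add he.tendsto_div_nhds_zero
      rw [add_zero] at h1
      have h2 := (Real.continuousAt_const_rpow (b := 1) hpos.ne').tendsto.comp h1
      rwa [Real.rpow_one] at h2
    rw [← (EReal.tendsto_coe.2 hlim).liminf_eq]
    refine liminf_le_liminf ?_
    filter_upwards [eventually_ge_atTop 1] with n hn
    have hn0 : (n : ℝ) ≠ 0 := by
      have : n ≠ 0 := by omega
      exact_mod_cast this
    rw [EReal.coe_le_coe_iff]
    calc sliceGap k ^ (1 + e n / n) = (sliceGap k ^ ((n : ℝ) + e n)) ^ (1 / (n : ℝ)) := by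
          rw [← Real.rpow_mul hpos.le]
          congr 1
          field_simp
      _ ≤ _ := Real.rpow_le_rpow (Real.rpow_nonneg hpos.le _) (hle n) (by positivity)
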